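/- Let $m>0$ and $a\in\mathbb R$ with $0\le a^2\le m^2$, and put $\lambda=r^2+a^2\cos^2\theta$, $\triangle=r^2-2mr+a^2$, $r_+=m+\sqrt{m^2-a^2}$. Consider on $\mathbb R\times\{x\in\mathbb R^3: |x|>r_+\}$ (outer Kerr spacetime) the Kerr metric, which in Boyer--Lindquist coordinates $(t,r,\theta,\varphi)$, with $(r,\theta,\varphi)$ the spherical coordinates of $\mathbb R^3$, is $$ds^2=\Big(-1+\frac{2mr}{\lambda}\Big)dt^2+\frac{\lambda}{\triangle}\,dr^2+\lambda\,d\theta^2+\Big(r^2+a^2+\frac{2mra^2\sin^2\theta}{\lambda}\Big)\sin^2\theta\,d\varphi^2-\frac{4mra\sin^2\theta}{\lambda}\,dt\,d\varphi ,$$ extended smoothly across the axis $\sin\theta=0$. A region is called geodesically connected if any two of its points can be joined by a geodesic of this metric (of any causal character) that lies in the region. Then: 1. For every $\nu>0$, the region of outer Kerr spacetime determined by $r>r_++\nu$ is not geodesically connected. 2. For every $\epsilon>0$, the region $M^a_\epsilon=\mathbb R\times\{x\in\mathbb R^3: r>m+\sqrt{m^2+\epsilon-a^2\cos^2\theta}\}$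 is not geodesically connected. Both statements include the case $a=0$. -/

import Mathlib

/-! ### Geodesics of a metric on an open subset of `ℝ⁴`, in coordinates -/

noncomputable section

namespace Kerr

/-- Coordinate partial derivative `∂ᵢ f` at `x`. -/
def pderiv (i : Fin 4) (f : (Fin 4 → ℝ) → ℝ) (x : Fin 4 → ℝ) : ℝ :=
  fderiv ℝ f x (Pi.single i 1)

/-- Christoffel symbol of the second kind `Γᵏᵢⱼ` of the Levi-Civita connection of the metric with
component matrix `g`:
`Γᵏᵢⱼ = ½ ∑ₗ gᵏˡ (∂ᵢ gⱼₗ + ∂ⱼ gᵢₗ - ∂ₗ gᵢⱼ)`. -/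
def christoffel (g : (Fin 4 → ℝ) → Matrix (Fin 4) (Fin 4) ℝ) (k i j : Fin 4)
    (x : Fin 4 → ℝ) : ℝ :=
  (1 / 2) * ∑ l, (g x)⁻¹ k l *
    (pderiv i (fun y => g y j l) x + pderiv j (fun y => g y i l) x
      - pderiv l (fun y => g y i j) x)

/-- `γ : [0,1] → ℝ⁴` is a geodesic of `g` (affinely parametrized, of any causal character): it has
a velocity field `v = γ'`, and `v' ᵏ = - ∑ᵢⱼ Γᵏᵢⱼ(γ) vⁱ vʲ`. Derivatives at `0` and `1` are
one-sided. -/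
def IsGeodesic (g : (Fin 4 → ℝ) → Matrix (Fin 4) (Fin 4) ℝ) (γ : ℝ → Fin 4 → ℝ) : Prop :=
  ∃ v : ℝ → Fin 4 → ℝ, ∀ s ∈ Set.Icc (0 : ℝ) 1,
    HasDerivWithinAt γ (v s) (Set.Icc 0 1) s ∧
    HasDerivWithinAt v (fun k => -∑ i, ∑ j, christoffel g k i j (γ s) * v s i * v s j)
      (Set.Icc 0 1) s

/-- The region `U` with the metric `g` is geodesically connected: any two points of `U` are joined
by a geodesic that stays in `U`. -/
def GeodesicallyConnected (g : (Fin 4 → ℝ) → Matrix (Fin 4) (Fin 4) ℝ)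
    (U : Set (Fin 4 → ℝ)) : Prop :=
  ∀ p ∈ U, ∀ q ∈ U, ∃ γ : ℝ → Fin 4 → ℝ,
    IsGeodesic g γ ∧ (∀ s ∈ Set.Icc (0 : ℝ) 1, γ s ∈ U) ∧ γ 0 = p ∧ γ 1 = q

/-! ### The Kerr metric in Boyer-Lindquist coordinates -/

/-- `λ = r² + a² cos² θ`, as a function of `r` and `c = cos θ`. -/
def lam (a r c : ℝ) : ℝ := r ^ 2 + a ^ 2 * c ^ 2

/-- `△(r) = r² - 2 m r + a²`. -/
def Delta (m a r : ℝ) : ℝ := r ^ 2 - 2 * m * r + a ^ 2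

/-- The outer event horizon `r₊ = m + √(m² - a²)`. -/
def rPlus (m a : ℝ) : ℝ := m + Real.sqrt (m ^ 2 - a ^ 2)

/-- The Kerr metric of mass `m` and angular momentum `m a` in Boyer-Lindquist coordinates
`q = (t, r, θ, φ)`. -/
def boyerLindquist (m a : ℝ) (q : Fin 4 → ℝ) : Matrix (Fin 4) (Fin 4) ℝ :=
  let r := q 1
  let θ := q 2
  let l := lam a r (Real.cos θ)
  let gtt := -1 + 2 * m * r / l
  let grr := l / Delta m a r
  let gpp := (r ^ 2 + a ^ 2 + 2 * m * r * a ^ 2 * Real.sin θ ^ 2 / l) * Real.sin θ ^ 2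
  let gtp := -(2 * m * r * a * Real.sin θ ^ 2 / l)
  !![gtt, 0, 0, gtp;
     0, grr, 0, 0;
     0, 0, l, 0;
     gtp, 0, 0, gpp]

/-! ### The Kerr metric on `ℝ × ℝ³`, with the axis included

The Boyer-Lindquist coordinates `(r, θ, φ)` are spherical coordinates on `ℝ³`. They degenerate on
the `z`-axis, across which the metric extends smoothly. We therefore write the metric in the
coordinates `x = (t, x₁, x₂, x₃)` of `ℝ × ℝ³`. -/

/-- The map `(t, r, θ, φ) ↦ (t, r sin θ cos φ, r sin θ sin φ, r cos θ)`. -/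
def spherical (q : Fin 4 → ℝ) : Fin 4 → ℝ :=
  ![q 0, q 1 * Real.sin (q 2) * Real.cos (q 3), q 1 * Real.sin (q 2) * Real.sin (q 3),
    q 1 * Real.cos (q 2)]

/-- The radial coordinate `r = |x|`. -/
def rad (x : Fin 4 → ℝ) : ℝ := Real.sqrt (x 1 ^ 2 + x 2 ^ 2 + x 3 ^ 2)

/-- `cos θ = x₃ / r`. -/
def cosTheta (x : Fin 4 → ℝ) : ℝ := x 3 / rad x

/-- The component vector of the 1-form `dt`. -/
def formT : Fin 4 → ℝ := ![1, 0, 0, 0]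

/-- The component vector of the 1-form `dr` at `x`. -/
def formR (x : Fin 4 → ℝ) : Fin 4 → ℝ := ![0, x 1 / rad x, x 2 / rad x, x 3 / rad x]

/-- The component vector at `x` of the 1-form `sin² θ dφ`, which is
`(x₁ dx₂ - x₂ dx₁) / r²`. -/
def formPhi (x : Fin 4 → ℝ) : Fin 4 → ℝ := ![0, -x 2 / rad x ^ 2, x 1 / rad x ^ 2, 0]

/-- The Kerr metric of mass `m` and angular momentum `m a` in the coordinates
`(t, x₁, x₂, x₃)`:
`g = (-1 + 2mr/λ) dt² + (λ/△) dr² + (λ/r²) (dx₁² + dx₂² + dx₃² - dr²)`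
`    + a² (1 + 2mr/λ) (sin² θ dφ)² - (4mra/λ) dt (sin² θ dφ)`.
It is obtained from the Boyer-Lindquist form by substituting
`dθ² = (dx₁² + dx₂² + dx₃² - dr²)/r² - sin² θ dφ²`; see `pullback_metric`. -/
def metric (m a : ℝ) (x : Fin 4 → ℝ) : Matrix (Fin 4) (Fin 4) ℝ :=
  let r := rad x
  let l := lam a r (cosTheta x)
  (-1 + 2 * m * r / l) • Matrix.vecMulVec formT formT
    + (l / Delta m a r) • Matrix.vecMulVec (formR x) (formR x)
    + (l / r ^ 2) • (Matrix.diagonal ![0, 1, 1, 1] - Matrix.vecMulVec (formR x) (formR x))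
    + (a ^ 2 * (1 + 2 * m * r / l)) • Matrix.vecMulVec (formPhi x) (formPhi x)
    - (2 * m * r * a / l) •
      (Matrix.vecMulVec formT (formPhi x) + Matrix.vecMulVec (formPhi x) formT)

lemma rad_spherical {q : Fin 4 → ℝ} (hr : 0 < q 1) : rad (spherical q) = q 1 := by
  have h : (spherical q) 1 ^ 2 + (spherical q) 2 ^ 2 + (spherical q) 3 ^ 2 = q 1 ^ 2 := by
    simp only [spherical, Matrix.cons_val]
    linear_combination (q 1) ^ 2 * Real.sin (q 2) ^ 2 * Real.sin_sq_add_cos_sq (q 3)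
      + (q 1) ^ 2 * Real.sin_sq_add_cos_sq (q 2)
  rw [rad, h, Real.sqrt_sq hr.le]

lemma cosTheta_spherical {q : Fin 4 → ℝ} (hr : 0 < q 1) :
    cosTheta (spherical q) = Real.cos (q 2) := by
  rw [cosTheta, rad_spherical hr]
  simp only [spherical, Matrix.cons_val]
  field_simp

/-- The Jacobian matrix `∂ xⱼ / ∂ qᵢ` of `spherical` (row `j`, column `i`). -/
def sphericalJacobian (q : Fin 4 → ℝ) : Matrix (Fin 4) (Fin 4) ℝ :=
  Matrix.of fun j i => pderiv i (fun y => spherical y j) q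

lemma sphericalJacobian_eq (q : Fin 4 → ℝ) :
    sphericalJacobian q =
      !![1, 0, 0, 0;
         0, Real.sin (q 2) * Real.cos (q 3), q 1 * Real.cos (q 2) * Real.cos (q 3),
           -(q 1 * Real.sin (q 2) * Real.sin (q 3));
         0, Real.sin (q 2) * Real.sin (q 3), q 1 * Real.cos (q 2) * Real.sin (q 3),
           q 1 * Real.sin (q 2) * Real.cos (q 3);
         0, Real.cos (q 2), -(q 1 * Real.sin (q 2)), 0] := by
  have h (k : Fin 4) : HasFDerivAt (fun y : Fin 4 → ℝ => y k)
      (ContinuousLinearMap.proj (R := ℝ) (φ := fun _ : Fin 4 => ℝ) k) q :=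
    (ContinuousLinearMap.proj (R := ℝ) (φ := fun _ : Fin 4 => ℝ) k).hasFDerivAt
  have h0 := (h 0).fderiv
  have h1 := (((h 1).mul (h 2).sin).mul (h 3).cos).fderiv
  have h2 := (((h 1).mul (h 2).sin).mul (h 3).sin).fderiv
  have h3 := ((h 1).mul (h 2).cos).fderiv
  ext j i
  fin_cases j <;> simp only [sphericalJacobian, pderiv, spherical, Matrix.of_apply] <;>
    [erw [h0]; erw [h1]; erw [h2]; erw [h3]] <;>
    fin_cases i <;> simp <;> ring

/-- In Boyer-Lindquist coordinates, `metric` is the Boyer-Lindquist form of the Kerr metric. -/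
theorem pullback_metric (m a : ℝ) {q : Fin 4 → ℝ} (hr : 0 < q 1) :
    (sphericalJacobian q).transpose * metric m a (spherical q) * sphericalJacobian q
      = boyerLindquist m a q := by
  have hr' : q 1 ≠ 0 := hr.ne'
  have hR : formR (spherical q) = ![0, Real.sin (q 2) * Real.cos (q 3),
      Real.sin (q 2) * Real.sin (q 3), Real.cos (q 2)] := by
    rw [formR, rad_spherical hr]
    ext k
    fin_cases k <;> simp [spherical] <;> field_simp
  have hP : formPhi (spherical q) = ![0, -(Real.sin (q 2) * Real.sin (q 3)) / q 1,
      Real.sin (q 2) * Real.cos (q 3) / q 1, 0] := by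
    rw [formPhi, rad_spherical hr]
    ext k
    fin_cases k <;> simp [spherical] <;> field_simp
  -- the pulled back forms are `dt`, `dr`, `sin² θ dφ`
  have pT : Matrix.vecMul formT (sphericalJacobian q) = ![1, 0, 0, 0] := by
    rw [sphericalJacobian_eq]
    ext k
    fin_cases k <;> simp [Matrix.vecMul, dotProduct, Fin.sum_univ_four, formT]
  have pR : Matrix.vecMul (formR (spherical q)) (sphericalJacobian q) = ![0, 1, 0, 0] := by
    rw [sphericalJacobian_eq, hR]
    have e1 := Real.sin_sq_add_cos_sq (q 2)
    have e2 := Real.sin_sq_add_cos_sq (q 3)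
    ext k
    fin_cases k <;> simp [Matrix.vecMul, dotProduct, Fin.sum_univ_four] <;> grind
  have pP : Matrix.vecMul (formPhi (spherical q)) (sphericalJacobian q)
      = ![0, 0, 0, Real.sin (q 2) ^ 2] := by
    rw [sphericalJacobian_eq, hP]
    have e2 := Real.sin_sq_add_cos_sq (q 3)
    ext k
    fin_cases k <;> simp [Matrix.vecMul, dotProduct, Fin.sum_univ_four] <;> field_simp <;> grind
  have pD : (sphericalJacobian q).transpose * Matrix.diagonal ![0, 1, 1, 1] * sphericalJacobian q
      = Matrix.diagonal ![0, 1, q 1 ^ 2, q 1 ^ 2 * Real.sin (q 2) ^ 2] := by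
    rw [sphericalJacobian_eq]
    have e1 := Real.sin_sq_add_cos_sq (q 2)
    have e2 := Real.sin_sq_add_cos_sq (q 3)
    ext i k
    fin_cases i <;> fin_cases k <;>
      simp [Matrix.mul_apply, Fin.sum_univ_four, Matrix.diagonal_apply] <;> grind
  simp only [metric, rad_spherical hr, cosTheta_spherical hr, Matrix.mul_add, Matrix.add_mul,
    Matrix.mul_sub, Matrix.sub_mul, Matrix.mul_smul, Matrix.smul_mul, Matrix.mul_vecMulVec,
    Matrix.vecMulVec_mul, Matrix.mulVec_transpose, pT, pR, pP, pD]
  have hc : Real.cos (q 2) ^ 2 = 1 - Real.sin (q 2) ^ 2 := Real.cos_sq' (q 2)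
  have hl : lam a (q 1) (Real.cos (q 2)) ≠ 0 := by
    rw [lam]
    positivity
  have hl2 : lam a (q 1) (Real.cos (q 2)) = q 1 ^ 2 + a ^ 2 * (1 - Real.sin (q 2) ^ 2) := by
    rw [lam, hc]
  ext i k
  fin_cases i <;> fin_cases k <;>
    simp [boyerLindquist] <;> field_simp
  linear_combination (Real.sin (q 2) ^ 2 * lam a (q 1) (Real.cos (q 2))) * hl2

/-- The metric is nondegenerate away from the horizons. -/
theorem det_metric (m a : ℝ) {x : Fin 4 → ℝ} (hr : 0 < rad x) (hD : Delta m a (rad x) ≠ 0) :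
    (metric m a x).det = -(lam a (rad x) (cosTheta x) / rad x ^ 2) ^ 2 := by
  have hr' : rad x ≠ 0 := hr.ne'
  have hn : (x 1 / rad x) ^ 2 + (x 2 / rad x) ^ 2 + (x 3 / rad x) ^ 2 = 1 := by
    have : rad x ^ 2 = x 1 ^ 2 + x 2 ^ 2 + x 3 ^ 2 := Real.sq_sqrt (by positivity)
    field_simp
    linarith
  have hP : formPhi x = ![0, -(x 2 / rad x) / rad x, (x 1 / rad x) / rad x, 0] := by
    ext k
    fin_cases k <;> simp [formPhi] <;> field_simp
  have hl : lam a (rad x) (cosTheta x) ≠ 0 := by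
    rw [lam]
    positivity
  have hl2 : lam a (rad x) (cosTheta x) = rad x ^ 2 + a ^ 2 * (x 3 / rad x) ^ 2 := rfl
  have hD2 : Delta m a (rad x) = rad x ^ 2 - 2 * m * rad x + a ^ 2 := rfl
  have key : ∀ A B C D E n1 n2 n3 r : ℝ, n1 ^ 2 + n2 ^ 2 + n3 ^ 2 = 1 →
      (A • Matrix.vecMulVec formT formT + B • Matrix.vecMulVec ![0, n1, n2, n3] ![0, n1, n2, n3]
        + C • (Matrix.diagonal ![0, 1, 1, 1]
            - Matrix.vecMulVec ![0, n1, n2, n3] ![0, n1, n2, n3])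
        + D • Matrix.vecMulVec ![0, -n2 / r, n1 / r, 0] ![0, -n2 / r, n1 / r, 0]
        - E • (Matrix.vecMulVec formT ![0, -n2 / r, n1 / r, 0]
            + Matrix.vecMulVec ![0, -n2 / r, n1 / r, 0] formT)).det
      = B * C * (A * (C + D * ((1 - n3 ^ 2) / r ^ 2)) - E ^ 2 * ((1 - n3 ^ 2) / r ^ 2)) := by
    intro A B C D E n1 n2 n3 r h
    have h3 : 1 - n3 ^ 2 = n1 ^ 2 + n2 ^ 2 := by linarith
    have hB : B = C + (B - C) * (n1 ^ 2 + n2 ^ 2 + n3 ^ 2) := by rw [h]; ring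
    rw [h3]
    conv_rhs => rw [hB]
    simp [Matrix.det_succ_row_zero, Fin.sum_univ_succ, formT, Matrix.diagonal_apply,
      Fin.succAbove, Matrix.submatrix_apply]
    ring
  simp only [metric, hP, formR]
  rw [key _ _ _ _ _ _ _ _ _ hn]
  generalize x 3 / rad x = c at *
  generalize lam a (rad x) (cosTheta x) = l at *
  generalize Delta m a (rad x) = d at *
  generalize rad x = r at *
  have hmr : 2 * m * r = r ^ 2 + a ^ 2 - d := by linarith
  rw [hmr]
  field_simp
  subst hl2
  ring

/-! ### The regions -/

/-- The region `r > r₊ + ν` of outer Kerr spacetime. -/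
def outerRegion (m a ν : ℝ) : Set (Fin 4 → ℝ) :=
  {x | rPlus m a + ν < rad x}

/-- The region `M^a_ε`, given by `r > m + √(m² + ε - a² cos² θ)`. -/
def stationaryRegion (m a ε : ℝ) : Set (Fin 4 → ℝ) :=
  {x | m + Real.sqrt (m ^ 2 + ε - a ^ 2 * cosTheta x ^ 2) < rad x}

end Kerr

end

/-!
The proof joins a point `(0, 0, 0, R)` of the axis to its antipode `(0, 0, 0, -R)` at the same time
and shows that every geodesic between them leaves `{r > r₀}` if `r₀ > r₊` and `R` is close to `r₀`
(`Kerr.exists_axis_points_not_joined`). Both kinds of region lie in such a set `{r > r₀}` and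
contain its part of the axis; for the region of parameter `ε`, `r₀ = m + √(m² + ε - a²)`.

Along a geodesic the momenta of the Killing fields `∂ₜ` and `∂_φ` and the speed `k = g(γ', γ')` are
constant. As `∂_φ` vanishes on the axis, the angular momentum is zero. Then `α pₜ = -△ t'` with
`α, △ > 0`, so `t'` has a constant sign; since `t` returns to its initial value, `t' = 0` and
`sin² θ φ' = 0` throughout (`Kerr.static_of_axis_of_time_eq`). This argument also works inside the
ergosphere. What is left is a geodesic of the metric `λ (dr² / △ + dθ²)`, so `k ≥ 0`, and
`w = λ r' / √△` satisfies `w' = r √△ k / λ ≥ 0` (`Kerr.hasDerivWithinAt_radialMomentum`). Hence `w`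
is nondecreasing, it vanishes at some `σ`, and `r ≤ R`. On the compact range `r₀ ≤ r ≤ r₀ + 1` this
gives `r(s) - r(σ) ≥ c k (s - σ)²` with `c` independent of `R` (`Kerr.turning_point_growth`). On the
other hand `cos θ` goes from `1` to `-1` with `|(cos θ)'| ≤ √k / r₀`, so `k (s - σ)² ≥ r₀²` for one
of the endpoints `s`. Thus `R - r₀ ≥ c r₀²`.

No coordinate derivative of the Kerr metric is computed. The geodesic equation is put into its
Lagrangian form for a general metric, and the change of the momentum in the direction of a vector
field is read off from a variation with that initial velocity
(`Kerr.hasDerivWithinAt_momentum_of_variation`): time translations, rotations about the axis, and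
dilations of space, under which `r` scales and `θ` is fixed.
-/

noncomputable section

namespace Kerr

open Set

/-! ### Geodesics in Lagrangian form -/

/-- The inner product `g_x(u, w)` of the vectors with components `u` and `w`. -/
def pairing (g : (Fin 4 → ℝ) → Matrix (Fin 4) (Fin 4) ℝ) (x u w : Fin 4 → ℝ) : ℝ :=
  ∑ i, ∑ j, g x i j * u i * w j

/-- The derivative `(D_ξ g)_x(u, w)` of the metric components in the direction `ξ`, applied to
the vectors `u` and `w`. -/
def pairingDeriv (g : (Fin 4 → ℝ) → Matrix (Fin 4) (Fin 4) ℝ) (x ξ u w : Fin 4 → ℝ) : ℝ :=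
  ∑ i, ∑ j, fderiv ℝ (fun y => g y i j) x ξ * u i * w j

variable {g : (Fin 4 → ℝ) → Matrix (Fin 4) (Fin 4) ℝ} {S : Set ℝ} {τ : ℝ}

lemma pairing_comm (hs : ∀ x, (g x).IsSymm) (x u w : Fin 4 → ℝ) :
    pairing g x u w = pairing g x w u := by
  rw [pairing, Finset.sum_comm, pairing]
  refine Finset.sum_congr rfl fun i _ => Finset.sum_congr rfl fun j _ => ?_
  rw [(hs x).apply]
  ring

lemma fderiv_apply_eq_sum_pderiv (f : (Fin 4 → ℝ) → ℝ) (x u : Fin 4 → ℝ) :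
    fderiv ℝ f x u = ∑ i, u i * pderiv i f x := by
  conv_lhs => rw [pi_eq_sum_univ' u]
  rw [map_sum]
  refine Finset.sum_congr rfl fun i _ => ?_
  rw [map_smul, smul_eq_mul, pderiv]

lemma hasDerivWithinAt_pairing {c u w : ℝ → Fin 4 → ℝ} {c' u' w' : Fin 4 → ℝ}
    (hg : ∀ i j, DifferentiableAt ℝ (fun y => g y i j) (c τ))
    (hc : HasDerivWithinAt c c' S τ) (hu : HasDerivWithinAt u u' S τ)
    (hw : HasDerivWithinAt w w' S τ) :
    HasDerivWithinAt (fun σ => pairing g (c σ) (u σ) (w σ))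
      (pairingDeriv g (c τ) c' (u τ) (w τ) + pairing g (c τ) u' (w τ)
        + pairing g (c τ) (u τ) w') S τ := by
  have h : HasDerivWithinAt (fun σ => pairing g (c σ) (u σ) (w σ))
      (∑ i, ∑ j, ((fderiv ℝ (fun y => g y i j) (c τ) c' * u τ i + g (c τ) i j * u' i) * w τ j
        + g (c τ) i j * u τ i * w' j)) S τ := by
    unfold pairing
    refine HasDerivWithinAt.fun_sum fun i _ => HasDerivWithinAt.fun_sum fun j _ => ?_
    exact (((hg i j).hasFDerivAt.comp_hasDerivWithinAt τ hc).mul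
      ((hasDerivWithinAt_pi.1 hu) i)).mul ((hasDerivWithinAt_pi.1 hw) j)
  convert h using 1
  simp only [pairing, pairingDeriv, ← Finset.sum_add_distrib]
  refine Finset.sum_congr rfl fun i _ => Finset.sum_congr rfl fun j _ => ?_
  ring

/-- The geodesic acceleration lowered with the metric: the inverse metric in the Christoffel
symbols cancels. -/
lemma pairing_acceleration (hs : ∀ x, (g x).IsSymm) {x : Fin 4 → ℝ} (hdet : (g x).det ≠ 0)
    (ξ v : Fin 4 → ℝ) :
    pairing g x ξ (fun k => -∑ i, ∑ j, christoffel g k i j x * v i * v j)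
      = pairingDeriv g x ξ v v / 2 - pairingDeriv g x v ξ v := by
  have hinv : g x * (g x)⁻¹ = 1 := Matrix.mul_nonsing_inv _ (isUnit_iff_ne_zero.2 hdet)
  have hsym : ∀ l j, (fun y => g y l j) = fun y => g y j l := fun l j => by
    ext y
    exact (hs y).apply j l
  have hlow : ∀ l i j, ∑ k, g x l k * christoffel g k i j x
      = (pderiv i (fun y => g y j l) x + pderiv j (fun y => g y i l) x
        - pderiv l (fun y => g y i j) x) / 2 := by
    intro l i j
    simp only [christoffel]
    obtain ⟨D, hD⟩ : ∃ D : Fin 4 → ℝ, ∀ n, pderiv i (fun y => g y j n) x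
      + pderiv j (fun y => g y i n) x - pderiv n (fun y => g y i j) x = D n :=
        ⟨_, fun _ => rfl⟩
    simp only [hD]
    have e : (g x).mulVec ((g x)⁻¹.mulVec D) = D := by
      rw [Matrix.mulVec_mulVec, hinv, Matrix.one_mulVec]
    have e' := congrFun e l
    simp only [Matrix.mulVec, dotProduct] at e'
    rw [← e', Finset.sum_div]
    refine Finset.sum_congr rfl fun k _ => ?_
    ring
  have hacc : ∀ l, ∑ k, g x l k * (-∑ i, ∑ j, christoffel g k i j x * v i * v j)
      = -∑ i, ∑ j, (pderiv i (fun y => g y j l) x + pderiv j (fun y => g y i l) x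
        - pderiv l (fun y => g y i j) x) / 2 * v i * v j := by
    intro l
    simp only [← hlow, Finset.sum_mul, Finset.mul_sum, mul_neg, Finset.sum_neg_distrib]
    congr 1
    rw [Finset.sum_comm]
    refine Finset.sum_congr rfl fun i _ => ?_
    rw [Finset.sum_comm]
    refine Finset.sum_congr rfl fun j _ => Finset.sum_congr rfl fun k _ => ?_
    ring
  have h1 : pairing g x ξ (fun k => -∑ i, ∑ j, christoffel g k i j x * v i * v j)
      = ∑ l, ξ l * ∑ k, g x l k * (-∑ i, ∑ j, christoffel g k i j x * v i * v j) := by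
    simp only [pairing]
    refine Finset.sum_congr rfl fun l _ => ?_
    rw [Finset.mul_sum]
    refine Finset.sum_congr rfl fun k _ => ?_
    ring
  rw [h1]
  obtain ⟨D, hD⟩ : ∃ D : Fin 4 → Fin 4 → Fin 4 → ℝ, ∀ n l j,
    pderiv n (fun y => g y l j) x = D n l j := ⟨_, fun _ _ _ => rfl⟩
  have hDs : ∀ n l j, D n l j = D n j l := fun n l j => by rw [← hD, ← hD, hsym]
  simp only [hacc, pairingDeriv, fderiv_apply_eq_sum_pderiv, hD]
  simp only [Fin.sum_univ_four]
  simp only [fun n => hDs n 1 0, fun n => hDs n 2 0, fun n => hDs n 3 0, fun n => hDs n 2 1,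
    fun n => hDs n 3 1, fun n => hDs n 3 2]
  ring

/-- The Euler-Lagrange equation along a geodesic, contracted with a vector field `ξ` along it. -/
lemma hasDerivWithinAt_momentum (hs : ∀ x, (g x).IsSymm) {γ v ξ : ℝ → Fin 4 → ℝ}
    {ξ' : Fin 4 → ℝ} (hg : ∀ i j, DifferentiableAt ℝ (fun y => g y i j) (γ τ))
    (hdet : (g (γ τ)).det ≠ 0) (hγ : HasDerivWithinAt γ (v τ) S τ)
    (hv : HasDerivWithinAt v (fun k => -∑ i, ∑ j, christoffel g k i j (γ τ) * v τ i * v τ j) S τ)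
    (hξ : HasDerivWithinAt ξ ξ' S τ) :
    HasDerivWithinAt (fun σ => pairing g (γ σ) (ξ σ) (v σ))
      (pairingDeriv g (γ τ) (ξ τ) (v τ) (v τ) / 2 + pairing g (γ τ) ξ' (v τ)) S τ := by
  convert hasDerivWithinAt_pairing hg hγ hξ hv using 1
  rw [pairing_acceleration hs hdet]
  ring

/-- Noether's identity: if the variation `(c, V)` of the point `γ τ` and the velocity `v τ` has
the initial velocity `(ξ, ξ')`, the momentum in the direction `ξ` changes at half the rate at which
the variation changes `g(V, V)`. -/
lemma hasDerivWithinAt_momentum_of_variation (hs : ∀ x, (g x).IsSymm)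
    {γ v ξ c V : ℝ → Fin 4 → ℝ}
    {ξ' : Fin 4 → ℝ} {F' σ : ℝ} (hg : ∀ i j, DifferentiableAt ℝ (fun y => g y i j) (γ τ))
    (hdet : (g (γ τ)).det ≠ 0) (hγ : HasDerivWithinAt γ (v τ) S τ)
    (hv : HasDerivWithinAt v (fun k => -∑ i, ∑ j, christoffel g k i j (γ τ) * v τ i * v τ j) S τ)
    (hξ : HasDerivWithinAt ξ ξ' S τ) (hc₀ : c σ = γ τ) (hV₀ : V σ = v τ)
    (hc : HasDerivAt c (ξ τ) σ) (hV : HasDerivAt V ξ' σ)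
    (hF : HasDerivAt (fun ρ => pairing g (c ρ) (V ρ) (V ρ)) F' σ) :
    HasDerivWithinAt (fun σ => pairing g (γ σ) (ξ σ) (v σ)) (F' / 2) S τ := by
  have h := hasDerivWithinAt_momentum hs hg hdet hγ hv hξ
  rw [← hc₀] at hg
  have h2 := hasDerivWithinAt_pairing hg (hasDerivWithinAt_univ.2 hc)
    (hasDerivWithinAt_univ.2 hV) (hasDerivWithinAt_univ.2 hV)
  have h3 := hF.unique (hasDerivWithinAt_univ.1 h2)
  rw [pairing_comm hs _ (V σ) ξ', hc₀, hV₀] at h3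
  convert h using 1
  rw [h3]
  ring

/-- The speed of a geodesic is conserved. -/
lemma hasDerivWithinAt_speed (hs : ∀ x, (g x).IsSymm) {γ v : ℝ → Fin 4 → ℝ}
    (hS : UniqueDiffWithinAt ℝ S τ)
    (hg : ∀ i j, DifferentiableAt ℝ (fun y => g y i j) (γ τ))
    (hdet : (g (γ τ)).det ≠ 0) (hγ : HasDerivWithinAt γ (v τ) S τ)
    (hv : HasDerivWithinAt v
      (fun k => -∑ i, ∑ j, christoffel g k i j (γ τ) * v τ i * v τ j) S τ) :
    HasDerivWithinAt (fun σ => pairing g (γ σ) (v σ) (v σ)) 0 S τ := by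
  have h1 := hasDerivWithinAt_momentum hs hg hdet hγ hv hv
  have h2 := hasDerivWithinAt_pairing hg hγ hv hv
  have h3 := hS.eq_deriv _ h1 h2
  rw [pairing_comm hs _ (v τ)] at h3
  convert h1 using 1
  linarith

/-! ### The Kerr metric as a quadratic form -/

lemma rad_sq (x : Fin 4 → ℝ) : rad x ^ 2 = x 1 ^ 2 + x 2 ^ 2 + x 3 ^ 2 :=
  Real.sq_sqrt (by positivity)

/-- The radial component `dr(u)` of the vector `u` at `x`. -/
def radComp (x u : Fin 4 → ℝ) : ℝ := (x 1 * u 1 + x 2 * u 2 + x 3 * u 3) / rad x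

/-- The value of `sin² θ dφ` on the vector `u` at `x`. -/
def phiComp (x u : Fin 4 → ℝ) : ℝ := (x 1 * u 2 - x 2 * u 1) / rad x ^ 2

lemma metric_isSymm (m a : ℝ) (x : Fin 4 → ℝ) : (metric m a x).IsSymm := by
  simp only [metric, Matrix.IsSymm, Matrix.transpose_add, Matrix.transpose_sub,
    Matrix.transpose_smul, Matrix.transpose_vecMulVec, Matrix.diagonal_transpose]
  rw [add_comm (Matrix.vecMulVec (formPhi x) formT)]

lemma pairing_metric (m a : ℝ) (x u w : Fin 4 → ℝ) :
    pairing (metric m a) x u w =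
      (-1 + 2 * m * rad x / lam a (rad x) (cosTheta x)) * (u 0 * w 0)
      + lam a (rad x) (cosTheta x) / Delta m a (rad x) * (radComp x u * radComp x w)
      + lam a (rad x) (cosTheta x) / rad x ^ 2
        * (u 1 * w 1 + u 2 * w 2 + u 3 * w 3 - radComp x u * radComp x w)
      + a ^ 2 * (1 + 2 * m * rad x / lam a (rad x) (cosTheta x)) * (phiComp x u * phiComp x w)
      - 2 * m * rad x * a / lam a (rad x) (cosTheta x)
        * (u 0 * phiComp x w + phiComp x u * w 0) := by
  simp [pairing, metric, Fin.sum_univ_four, Matrix.diagonal_apply, formT, formR,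
    formPhi, radComp, phiComp]
  ring

lemma differentiableAt_rad {x : Fin 4 → ℝ} (hx : 0 < rad x) : DifferentiableAt ℝ rad x := by
  unfold rad
  refine DifferentiableAt.sqrt (by fun_prop) ?_
  rw [← rad_sq]
  positivity

lemma differentiableAt_cosTheta {x : Fin 4 → ℝ} (hx : 0 < rad x) :
    DifferentiableAt ℝ cosTheta x := by
  have := differentiableAt_rad hx
  unfold cosTheta
  fun_prop (disch := exact hx.ne')

lemma lam_pos {r : ℝ} (a c : ℝ) (hr : 0 < r) : 0 < lam a r c := by
  rw [lam]
  positivity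

lemma differentiableAt_metric (m a : ℝ) {x : Fin 4 → ℝ} (hx : 0 < rad x)
    (hD : Delta m a (rad x) ≠ 0) (i j : Fin 4) :
    DifferentiableAt ℝ (fun y => metric m a y i j) x := by
  have hr := differentiableAt_rad hx
  have hc := differentiableAt_cosTheta hx
  have hl : DifferentiableAt ℝ (fun y => lam a (rad y) (cosTheta y)) x := by
    unfold lam
    fun_prop
  have hd : DifferentiableAt ℝ (fun y => Delta m a (rad y)) x := by
    unfold Delta
    fun_prop
  have hl0 := (lam_pos a (cosTheta x) hx).ne'
  have hR : ∀ k, DifferentiableAt ℝ (fun y => formR y k) x := by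
    intro k
    fin_cases k <;> simp [formR] <;> fun_prop (disch := exact hx.ne')
  have hP : ∀ k, DifferentiableAt ℝ (fun y => formPhi y k) x := by
    intro k
    fin_cases k <;> simp [formPhi] <;> fun_prop (disch := positivity)
  have hRi := hR i
  have hRj := hR j
  have hPi := hP i
  have hPj := hP j
  simp only [metric, Matrix.add_apply, Matrix.sub_apply, Matrix.smul_apply, Matrix.vecMulVec_apply,
    smul_eq_mul]
  fun_prop (disch := first | assumption | positivity)

lemma rPlus_pos {m : ℝ} (hm : 0 < m) (a : ℝ) : 0 < rPlus m a :=
  add_pos_of_pos_of_nonneg hm (Real.sqrt_nonneg _)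

lemma Delta_eq (m a r : ℝ) : Delta m a r = (r - m) ^ 2 - (m ^ 2 - a ^ 2) := by
  rw [Delta]
  ring

lemma Delta_pos {m a r : ℝ} (hr : rPlus m a < r) : 0 < Delta m a r := by
  have h : Real.sqrt (m ^ 2 - a ^ 2) < r - m := by
    rw [rPlus] at hr
    linarith
  have := (Real.sqrt_lt' ((Real.sqrt_nonneg _).trans_lt h)).1 h
  rw [Delta_eq]
  linarith

lemma Delta_mono {m a r r' : ℝ} (hr : rPlus m a ≤ r) (h : r ≤ r') :
    Delta m a r ≤ Delta m a r' := by
  have : 0 ≤ r - m := by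
    have := Real.sqrt_nonneg (m ^ 2 - a ^ 2)
    rw [rPlus] at hr
    linarith
  rw [Delta_eq, Delta_eq]
  gcongr

/-! ### Momenta -/

/-- The generator of the rotations about the axis. -/
def rotGen (x : Fin 4 → ℝ) : Fin 4 → ℝ := ![0, -x 2, x 1, 0]

/-- Rotation about the axis by the angle `σ`. -/
def rot (σ : ℝ) (x : Fin 4 → ℝ) : Fin 4 → ℝ :=
  ![x 0, Real.cos σ * x 1 - Real.sin σ * x 2, Real.sin σ * x 1 + Real.cos σ * x 2, x 3]

/-- The spatial part of `x`, which generates the dilations of space. -/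
def spatial (x : Fin 4 → ℝ) : Fin 4 → ℝ := ![0, x 1, x 2, x 3]

/-- Dilation of space by the factor `ρ`. -/
def dil (ρ : ℝ) (x : Fin 4 → ℝ) : Fin 4 → ℝ := ![x 0, ρ * x 1, ρ * x 2, ρ * x 3]

lemma hasDerivAt_rot (x : Fin 4 → ℝ) : HasDerivAt (fun σ => rot σ x) (rotGen x) 0 := by
  have hc := Real.hasDerivAt_cos 0
  have hs := Real.hasDerivAt_sin 0
  refine hasDerivAt_pi.2 fun k => ?_
  fin_cases k
  · exact hasDerivAt_const _ _
  · exact ((hc.mul_const (x 1)).fun_sub (hs.mul_const (x 2))).congr_deriv (by simp [rotGen])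
  · exact ((hs.mul_const (x 1)).fun_add (hc.mul_const (x 2))).congr_deriv (by simp [rotGen])
  · exact hasDerivAt_const _ _

lemma hasDerivAt_dil (x : Fin 4 → ℝ) : HasDerivAt (fun σ => dil σ x) (spatial x) 1 := by
  refine hasDerivAt_pi.2 fun k => ?_
  fin_cases k
  · exact hasDerivAt_const _ _
  all_goals
    exact ((hasDerivAt_id' (1 : ℝ)).mul_const _).congr_deriv (by simp [spatial])

lemma rot_zero (x : Fin 4 → ℝ) : rot 0 x = x := by
  ext k
  fin_cases k <;> simp [rot]

lemma dil_one (x : Fin 4 → ℝ) : dil 1 x = x := by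
  ext k
  fin_cases k <;> simp [dil]

lemma rad_rot (σ : ℝ) (x : Fin 4 → ℝ) : rad (rot σ x) = rad x := by
  rw [rad, rad]
  congr 1
  simp only [rot, Matrix.cons_val]
  linear_combination (x 1 ^ 2 + x 2 ^ 2) * Real.sin_sq_add_cos_sq σ

lemma rad_dil {ρ : ℝ} (hρ : 0 < ρ) (x : Fin 4 → ℝ) : rad (dil ρ x) = ρ * rad x := by
  rw [rad, rad, ← Real.sqrt_sq hρ.le, ← Real.sqrt_mul (sq_nonneg ρ), Real.sqrt_sq hρ.le]
  congr 1
  simp only [dil, Matrix.cons_val]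
  ring

lemma cosTheta_dil {ρ : ℝ} (hρ : 0 < ρ) (x : Fin 4 → ℝ) :
    cosTheta (dil ρ x) = cosTheta x := by
  rw [cosTheta, rad_dil hρ, cosTheta]
  simp only [dil, Matrix.cons_val]
  exact mul_div_mul_left _ _ hρ.ne'

lemma pairing_metric_rot (m a σ : ℝ) (x v : Fin 4 → ℝ) :
    pairing (metric m a) (rot σ x) (rot σ v) (rot σ v) = pairing (metric m a) x v v := by
  have h := Real.sin_sq_add_cos_sq σ
  have hR : radComp (rot σ x) (rot σ v) = radComp x v := by
    rw [radComp, radComp, rad_rot]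
    congr 1
    simp only [rot, Matrix.cons_val]
    linear_combination (x 1 * v 1 + x 2 * v 2) * h
  have hP : phiComp (rot σ x) (rot σ v) = phiComp x v := by
    rw [phiComp, phiComp, rad_rot]
    congr 1
    simp only [rot, Matrix.cons_val]
    linear_combination (x 1 * v 2 - x 2 * v 1) * h
  have hc : cosTheta (rot σ x) = cosTheta x := by
    rw [cosTheta, rad_rot]
    simp [rot, cosTheta]
  have hE : rot σ v 1 * rot σ v 1 + rot σ v 2 * rot σ v 2 + rot σ v 3 * rot σ v 3
      = v 1 * v 1 + v 2 * v 2 + v 3 * v 3 := by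
    simp only [rot, Matrix.cons_val]
    linear_combination (v 1 ^ 2 + v 2 ^ 2) * h
  have h0 : rot σ v 0 = v 0 := rfl
  rw [pairing_metric, pairing_metric, hR, hP, hc, hE, rad_rot, h0]

/-- The variation of `g(v, v)` under dilations, for a vector `v` on which `dt` and `sin² θ dφ`
vanish. -/
lemma hasDerivAt_pairing_metric_dil {m a : ℝ} {x v : Fin 4 → ℝ} (hx : 0 < rad x)
    (hD : Delta m a (rad x) ≠ 0) (hv : v 0 = 0) (hP : phiComp x v = 0) :
    HasDerivAt (fun ρ => pairing (metric m a) (dil ρ x) (dil ρ v) (dil ρ v))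
      (2 * rad x * ((rad x / Delta m a (rad x)
          - lam a (rad x) (cosTheta x) * (rad x - m) / Delta m a (rad x) ^ 2
          + lam a (rad x) (cosTheta x) / (rad x * Delta m a (rad x))) * radComp x v ^ 2
        + (v 1 ^ 2 + v 2 ^ 2 + v 3 ^ 2 - radComp x v ^ 2) / rad x)) 1 := by
  have hF : (fun ρ => pairing (metric m a) (dil ρ x) (dil ρ v) (dil ρ v)) =ᶠ[nhds 1]
      fun ρ => lam a (ρ * rad x) (cosTheta x) / Delta m a (ρ * rad x) * (ρ ^ 2 * radComp x v ^ 2)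
        + lam a (ρ * rad x) (cosTheta x)
          * ((v 1 ^ 2 + v 2 ^ 2 + v 3 ^ 2 - radComp x v ^ 2) / rad x ^ 2) := by
    filter_upwards [lt_mem_nhds (one_pos : (0 : ℝ) < 1)] with ρ hρ
    have hR : radComp (dil ρ x) (dil ρ v) = ρ * radComp x v := by
      rw [radComp, radComp, rad_dil hρ]
      simp only [dil, Matrix.cons_val]
      field_simp
    have hP' : phiComp (dil ρ x) (dil ρ v) = 0 := by
      rw [← hP, phiComp, phiComp, rad_dil hρ]
      simp only [dil, Matrix.cons_val]
      field_simp
    have h0 : dil ρ v 0 = 0 := hv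
    rw [pairing_metric, hR, hP', h0, rad_dil hρ, cosTheta_dil hρ]
    simp only [dil, Matrix.cons_val]
    field_simp
    ring
  refine HasDerivAt.congr_of_eventuallyEq ?_ hF
  have hr : HasDerivAt (fun ρ : ℝ => ρ * rad x) (rad x) 1 := by
    simpa using (hasDerivAt_id (1 : ℝ)).mul_const (rad x)
  have hl : HasDerivAt (fun ρ : ℝ => lam a (ρ * rad x) (cosTheta x)) (2 * rad x ^ 2) 1 := by
    simp only [lam]
    refine ((hr.fun_pow 2).add_const _).congr_deriv ?_
    push_cast
    ring
  have hd : HasDerivAt (fun ρ : ℝ => Delta m a (ρ * rad x)) (2 * rad x * (rad x - m)) 1 := by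
    simp only [Delta]
    refine (((hr.fun_pow 2).fun_sub (hr.const_mul (2 * m))).add_const (a ^ 2)).congr_deriv ?_
    push_cast
    ring
  have h := ((hl.fun_div hd (by simpa using hD)).fun_mul
    (((hasDerivAt_id' (1 : ℝ)).fun_pow 2).mul_const (radComp x v ^ 2))).fun_add
      (hl.mul_const ((v 1 ^ 2 + v 2 ^ 2 + v 3 ^ 2 - radComp x v ^ 2) / rad x ^ 2))
  refine h.congr_deriv ?_
  have hx' := hx.ne'
  rw [one_mul]
  field_simp
  ring

lemma pairing_metric_spatial {m a : ℝ} {x : Fin 4 → ℝ} (hx : 0 < rad x) (v : Fin 4 → ℝ) :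
    pairing (metric m a) x (spatial x) v
      = rad x * (lam a (rad x) (cosTheta x) / Delta m a (rad x) * radComp x v) := by
  have h1 : radComp x (spatial x) = rad x := by
    rw [radComp, div_eq_iff hx.ne', ← sq, rad_sq]
    simp only [spatial, Matrix.cons_val]
    ring
  have h2 : phiComp x (spatial x) = 0 := by
    simp [phiComp, spatial, mul_comm]
  have h3 : radComp x v * rad x = x 1 * v 1 + x 2 * v 2 + x 3 * v 3 := by
    rw [radComp, div_mul_cancel₀ _ hx.ne']
  rw [pairing_metric, h1, h2]
  simp only [spatial, Matrix.cons_val]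
  rw [← h3]
  ring

/-- The angular momentum of `v`. -/
lemma pairing_metric_rotGen {m a : ℝ} {x : Fin 4 → ℝ} (hx : 0 < rad x) (v : Fin 4 → ℝ) :
    pairing (metric m a) x (rotGen x) v
      = (rad x ^ 2 + a ^ 2 + 2 * m * rad x * a ^ 2 * (1 - cosTheta x ^ 2)
          / lam a (rad x) (cosTheta x)) * phiComp x v
        - 2 * m * rad x * a / lam a (rad x) (cosTheta x) * (1 - cosTheta x ^ 2) * v 0 := by
  have h1 : radComp x (rotGen x) = 0 := by
    simp [radComp, rotGen, mul_comm]
  have h2 : phiComp x (rotGen x) = 1 - cosTheta x ^ 2 := by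
    have := rad_sq x
    simp only [phiComp, rotGen, cosTheta, Matrix.cons_val]
    field_simp
    linarith
  have h3 : phiComp x v * rad x ^ 2 = x 1 * v 2 - x 2 * v 1 := by
    rw [phiComp, div_mul_cancel₀ _ (by positivity)]
  have hl := lam_pos a (cosTheta x) hx
  have hl' : lam a (rad x) (cosTheta x) = rad x ^ 2 + a ^ 2 * cosTheta x ^ 2 := rfl
  rw [pairing_metric, h1, h2]
  simp only [rotGen, Matrix.cons_val]
  rw [show -x 2 * v 1 + x 1 * v 2 + 0 * v 3 - 0 * radComp x v = phiComp x v * rad x ^ 2 by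
    rw [h3]; ring]
  generalize lam a (rad x) (cosTheta x) = l at *
  field_simp
  subst hl'
  ring

/-- The momentum in the direction of `∂ₜ`. -/
lemma pairing_metric_time (m a : ℝ) (x v : Fin 4 → ℝ) :
    pairing (metric m a) x ![1, 0, 0, 0] v
      = (-1 + 2 * m * rad x / lam a (rad x) (cosTheta x)) * v 0
        - 2 * m * rad x * a / lam a (rad x) (cosTheta x) * phiComp x v := by
  rw [pairing_metric]
  simp [radComp, phiComp]

lemma cosTheta_sq_le_one {x : Fin 4 → ℝ} (hx : 0 < rad x) : cosTheta x ^ 2 ≤ 1 := by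
  rw [cosTheta, div_pow, div_le_one (by positivity), rad_sq]
  nlinarith [sq_nonneg (x 1), sq_nonneg (x 2)]

/-- The coefficient `α = r² + a² + 2 m r a² sin² θ / λ` of the metric, for which
`g_φφ = α sin² θ`. -/
def phiCoeff (m a : ℝ) (x : Fin 4 → ℝ) : ℝ :=
  rad x ^ 2 + a ^ 2 + 2 * m * rad x * a ^ 2 * (1 - cosTheta x ^ 2) / lam a (rad x) (cosTheta x)

lemma phiCoeff_pos {m : ℝ} (hm : 0 < m) (a : ℝ) {x : Fin 4 → ℝ} (hx : 0 < rad x) :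
    0 < phiCoeff m a x := by
  have h1 := lam_pos a (cosTheta x) hx
  have h2 : 0 ≤ 1 - cosTheta x ^ 2 := by linarith [cosTheta_sq_le_one hx]
  rw [phiCoeff]
  positivity

/-- Without angular momentum, `α pₜ = - △ t'`; so the time component of the velocity has the sign
of `-pₜ` outside the horizon, also where `∂ₜ` is spacelike. -/
lemma phiCoeff_mul_pairing_time {m a : ℝ} {x v : Fin 4 → ℝ} (hx : 0 < rad x)
    (hL : pairing (metric m a) x (rotGen x) v = 0) :
    phiCoeff m a x * pairing (metric m a) x ![1, 0, 0, 0] v = -Delta m a (rad x) * v 0 := by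
  rw [pairing_metric_rotGen hx] at hL
  have hL' : phiCoeff m a x * phiComp x v
      = 2 * m * rad x * a / lam a (rad x) (cosTheta x) * (1 - cosTheta x ^ 2) * v 0 := by
    rw [phiCoeff]
    linarith
  rw [pairing_metric_time, mul_sub, mul_left_comm _ (_ / _) (phiComp x v), hL', phiCoeff]
  have hl := lam_pos a (cosTheta x) hx
  have hl' : lam a (rad x) (cosTheta x) = rad x ^ 2 + a ^ 2 * cosTheta x ^ 2 := rfl
  rw [Delta]
  generalize lam a (rad x) (cosTheta x) = l at *
  field_simp
  subst hl'
  ring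

/-! ### Monotonicity on intervals -/

lemma monotoneOn_Icc_of_hasDerivWithinAt {f f' : ℝ → ℝ} {p q : ℝ} {S : Set ℝ}
    (hS : Icc p q ⊆ S) (h : ∀ s ∈ Icc p q, HasDerivWithinAt f (f' s) S s)
    (h0 : ∀ s ∈ Icc p q, 0 ≤ f' s) : MonotoneOn f (Icc p q) := by
  refine monotoneOn_of_hasDerivWithinAt_nonneg (f' := f') (convex_Icc p q)
    (fun s hs => ((h s hs).mono hS).continuousWithinAt) (fun s hs => ?_)
    (fun s hs => h0 s (interior_subset hs))
  exact (h s (interior_subset hs)).mono (interior_subset.trans hS)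

lemma antitoneOn_Icc_of_hasDerivWithinAt {f f' : ℝ → ℝ} {p q : ℝ} {S : Set ℝ}
    (hS : Icc p q ⊆ S) (h : ∀ s ∈ Icc p q, HasDerivWithinAt f (f' s) S s)
    (h0 : ∀ s ∈ Icc p q, f' s ≤ 0) : AntitoneOn f (Icc p q) := by
  refine antitoneOn_of_hasDerivWithinAt_nonpos (f' := f') (convex_Icc p q)
    (fun s hs => ((h s hs).mono hS).continuousWithinAt) (fun s hs => ?_)
    (fun s hs => h0 s (interior_subset hs))
  exact (h s (interior_subset hs)).mono (interior_subset.trans hS)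

lemma eq_of_hasDerivWithinAt_zero {f : ℝ → ℝ} {p q : ℝ}
    (h : ∀ s ∈ Icc p q, HasDerivWithinAt f 0 (Icc p q) s) {s t : ℝ} (hs : s ∈ Icc p q)
    (ht : t ∈ Icc p q) : f s = f t := by
  have := (convex_Icc p q).norm_image_sub_le_of_norm_hasDerivWithin_le (C := 0) h
    (fun _ _ => by simp) ht hs
  rw [zero_mul, norm_le_zero_iff, sub_eq_zero] at this
  exact this

/-- Quadratic growth away from a turning point `σ`, if `r' = β w` with `β ≥ b`, and `w` increases at
a rate of at least `K`. -/
lemma turning_point_growth {r w w' β : ℝ → ℝ} {p q σ K b : ℝ} (hσ : σ ∈ Icc p q) (hw0 : w σ = 0)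
    (hr : ∀ s ∈ Icc p q, HasDerivWithinAt r (β s * w s) (Icc p q) s)
    (hw : ∀ s ∈ Icc p q, HasDerivWithinAt w (w' s) (Icc p q) s)
    (hK : 0 ≤ K) (hb : 0 ≤ b) (hwK : ∀ s ∈ Icc p q, K ≤ w' s) (hβ : ∀ s ∈ Icc p q, b ≤ β s)
    {s : ℝ} (hs : s ∈ Icc p q) : b * K * (s - σ) ^ 2 / 2 ≤ r s - r σ := by
  have hmono : MonotoneOn (fun s => w s - K * s) (Icc p q) :=
    monotoneOn_Icc_of_hasDerivWithinAt Subset.rfl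
      (fun s hs => (hw s hs).fun_sub ((hasDerivWithinAt_id s _).const_mul K))
      (fun s hs => by linarith [hwK s hs])
  have hψ : ∀ s ∈ Icc p q, HasDerivWithinAt (fun s => r s - b * K * (s - σ) ^ 2 / 2)
      (β s * w s - b * (K * (s - σ))) (Icc p q) s := by
    intro s hs
    refine ((hr s hs).fun_sub (((((hasDerivWithinAt_id s _).sub_const σ).fun_pow 2).const_mul
      (b * K)).div_const 2)).congr_deriv ?_
    simp
    ring
  rcases le_total σ s with h | h
  · have hsub : Icc σ s ⊆ Icc p q := Icc_subset_Icc hσ.1 hs.2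
    have := monotoneOn_Icc_of_hasDerivWithinAt hsub (fun t ht => hψ t (hsub ht)) (fun t ht => by
      have h1 : w σ - K * σ ≤ w t - K * t := hmono hσ (hsub ht) ht.1
      have h2 : K * (t - σ) ≤ w t := by linarith
      have h3 : 0 ≤ K * (t - σ) := mul_nonneg hK (by linarith [ht.1])
      have := mul_le_mul (hβ t (hsub ht)) h2 h3 (hb.trans (hβ t (hsub ht)))
      linarith) (left_mem_Icc.2 h) (right_mem_Icc.2 h) h
    simp at this
    linarith
  · have hsub : Icc s σ ⊆ Icc p q := Icc_subset_Icc hs.1 hσ.2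
    have := antitoneOn_Icc_of_hasDerivWithinAt hsub (fun t ht => hψ t (hsub ht)) (fun t ht => by
      have h1 : w t - K * t ≤ w σ - K * σ := hmono (hsub ht) hσ ht.2
      have h2 : K * (σ - t) ≤ -w t := by linarith
      have h3 : 0 ≤ K * (σ - t) := mul_nonneg hK (by linarith [ht.2])
      have := mul_le_mul (hβ t (hsub ht)) h2 h3 (hb.trans (hβ t (hsub ht)))
      linarith) (left_mem_Icc.2 h) (right_mem_Icc.2 h) h
    simp at this
    linarith

/-- A function with derivative `β w`, where `β ≥ 0` and `w` is nondecreasing with a zero, is at most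
the larger of its values at the endpoints. -/
lemma le_of_turning_point {r w w' β : ℝ → ℝ} {p q σ R : ℝ} (hσ : σ ∈ Icc p q) (hw0 : w σ = 0)
    (hr : ∀ s ∈ Icc p q, HasDerivWithinAt r (β s * w s) (Icc p q) s)
    (hw : ∀ s ∈ Icc p q, HasDerivWithinAt w (w' s) (Icc p q) s)
    (hw' : ∀ s ∈ Icc p q, 0 ≤ w' s) (hβ : ∀ s ∈ Icc p q, 0 ≤ β s)
    (hp : r p ≤ R) (hq : r q ≤ R) {s : ℝ} (hs : s ∈ Icc p q) : r s ≤ R := by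
  have hmono := monotoneOn_Icc_of_hasDerivWithinAt Subset.rfl hw hw'
  rcases le_total σ s with h | h
  · have hsub : Icc s q ⊆ Icc p q := Icc_subset_Icc hs.1 le_rfl
    have := monotoneOn_Icc_of_hasDerivWithinAt hsub (fun t ht => hr t (hsub ht)) (fun t ht =>
      mul_nonneg (hβ t (hsub ht)) (hw0.symm.le.trans (hmono hσ (hsub ht) (h.trans ht.1))))
      (left_mem_Icc.2 hs.2) (right_mem_Icc.2 hs.2) hs.2
    exact this.trans hq
  · have hsub : Icc p s ⊆ Icc p q := Icc_subset_Icc le_rfl hs.2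
    have := antitoneOn_Icc_of_hasDerivWithinAt hsub (fun t ht => hr t (hsub ht)) (fun t ht =>
      mul_nonpos_of_nonneg_of_nonpos (hβ t (hsub ht))
        ((hmono (hsub ht) hσ (ht.2.trans h)).trans hw0.le))
      (left_mem_Icc.2 hs.1) (right_mem_Icc.2 hs.1) hs.1
    exact this.trans hp

lemma exists_mem_Icc_deriv_eq_zero {f f' : ℝ → ℝ} {p q : ℝ} (hpq : p < q)
    (h : ∀ s ∈ Icc p q, HasDerivWithinAt f (f' s) (Icc p q) s) (hf : f p = f q) :
    ∃ s ∈ Icc p q, f' s = 0 := by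
  obtain ⟨s, hs, h0⟩ := exists_hasDerivAt_eq_zero hpq
    (fun s hs => (h s hs).continuousWithinAt) hf
    (fun s hs => (h s (Ioo_subset_Icc_self hs)).hasDerivAt (Icc_mem_nhds hs.1 hs.2))
  exact ⟨s, Ioo_subset_Icc_self hs, h0⟩

/-! ### Geodesics from the axis between points of equal time -/

section Geodesic

variable {m a : ℝ} {γ v : ℝ → Fin 4 → ℝ} {S : Set ℝ} {s : ℝ}

lemma hasDerivWithinAt_rad (hx : 0 < rad (γ s)) (hγ : HasDerivWithinAt γ (v s) S s) :
    HasDerivWithinAt (fun σ => rad (γ σ)) (radComp (γ s) (v s)) S s := by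
  have h := hasDerivWithinAt_pi.1 hγ
  have h0 : γ s 1 ^ 2 + γ s 2 ^ 2 + γ s 3 ^ 2 ≠ 0 := by
    rw [← rad_sq]
    positivity
  refine (((((h 1).fun_pow 2).fun_add ((h 2).fun_pow 2)).fun_add ((h 3).fun_pow 2)).sqrt
    h0).congr_deriv ?_
  change _ / (2 * rad (γ s)) = _
  rw [radComp]
  push_cast
  field_simp

lemma hasDerivWithinAt_cosTheta (hx : 0 < rad (γ s)) (hγ : HasDerivWithinAt γ (v s) S s) :
    HasDerivWithinAt (fun σ => cosTheta (γ σ))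
      ((v s 3 - cosTheta (γ s) * radComp (γ s) (v s)) / rad (γ s)) S s := by
  refine ((hasDerivWithinAt_pi.1 hγ 3).fun_div (hasDerivWithinAt_rad hx hγ) hx.ne').congr_deriv ?_
  rw [cosTheta]
  field_simp

/-- The `x₃`-component of the part of `u` orthogonal to the radial direction is at most the length
of that part. -/
lemma sq_sub_cosTheta_mul_radComp_le {x : Fin 4 → ℝ} (hx : 0 < rad x) (u : Fin 4 → ℝ) :
    (u 3 - cosTheta x * radComp x u) ^ 2 ≤ u 1 ^ 2 + u 2 ^ 2 + u 3 ^ 2 - radComp x u ^ 2 := by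
  have h1 : radComp x u * rad x = x 1 * u 1 + x 2 * u 2 + x 3 * u 3 := by
    rw [radComp, div_mul_cancel₀ _ hx.ne']
  have h2 := rad_sq x
  -- the components of `u` orthogonal to the radial direction
  have key : u 1 ^ 2 + u 2 ^ 2 + u 3 ^ 2 - radComp x u ^ 2
      = (u 1 - x 1 / rad x * radComp x u) ^ 2 + (u 2 - x 2 / rad x * radComp x u) ^ 2
        + (u 3 - cosTheta x * radComp x u) ^ 2 := by
    rw [cosTheta]
    generalize radComp x u = p at *
    field_simp
    linear_combination -(2 * p * rad x) * h1 + p ^ 2 * h2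
  rw [key]
  nlinarith [sq_nonneg (u 1 - x 1 / rad x * radComp x u),
    sq_nonneg (u 2 - x 2 / rad x * radComp x u)]

lemma pairing_metric_translate (m a σ : ℝ) (x u w : Fin 4 → ℝ) :
    pairing (metric m a) (x + σ • ![1, 0, 0, 0]) u w = pairing (metric m a) x u w := by
  have h (k : Fin 4) (hk : ![(1 : ℝ), 0, 0, 0] k = 0) : (x + σ • ![(1 : ℝ), 0, 0, 0]) k = x k := by
    rw [Pi.add_apply, Pi.smul_apply, hk, smul_zero, add_zero]
  simp only [pairing_metric, rad, cosTheta, radComp, phiComp, h 1 rfl, h 2 rfl, h 3 rfl]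

/-- The equation of a geodesic at the parameter `s`, in the form in which `IsGeodesic` states it. -/
def GeodesicAt (g : (Fin 4 → ℝ) → Matrix (Fin 4) (Fin 4) ℝ) (γ v : ℝ → Fin 4 → ℝ) (S : Set ℝ)
    (s : ℝ) : Prop :=
  HasDerivWithinAt γ (v s) S s ∧
    HasDerivWithinAt v (fun k => -∑ i, ∑ j, christoffel g k i j (γ s) * v s i * v s j) S s

lemma det_metric_ne_zero (hx : 0 < rad (γ s)) (hD : Delta m a (rad (γ s)) ≠ 0) :
    (metric m a (γ s)).det ≠ 0 := by
  have := lam_pos a (cosTheta (γ s)) hx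
  rw [det_metric m a hx hD]
  exact neg_ne_zero.2 (by positivity)

lemma hasDerivWithinAt_timeMomentum (h : GeodesicAt (metric m a) γ v S s)
    (hx : 0 < rad (γ s)) (hD : Delta m a (rad (γ s)) ≠ 0) :
    HasDerivWithinAt (fun σ => pairing (metric m a) (γ σ) ![1, 0, 0, 0] (v σ)) 0 S s := by
  have hc : HasDerivAt (fun σ : ℝ => γ s + σ • ![(1 : ℝ), 0, 0, 0]) ![1, 0, 0, 0] 0 :=
    (((hasDerivAt_id' (0 : ℝ)).smul_const _).const_add _).congr_deriv (one_smul _ _)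
  have hF : HasDerivAt (fun σ : ℝ => pairing (metric m a) (γ s + σ • ![(1 : ℝ), 0, 0, 0])
      (v s) (v s)) 0 0 := by
    simp only [pairing_metric_translate]
    exact hasDerivAt_const _ _
  have := hasDerivWithinAt_momentum_of_variation (V := fun _ => v s) (metric_isSymm m a)
    (differentiableAt_metric m a hx hD) (det_metric_ne_zero hx hD) h.1 h.2
    (hasDerivWithinAt_const s S ![1, 0, 0, 0]) (by simp) rfl hc (hasDerivAt_const (0 : ℝ) (v s)) hF
  simpa using this

lemma hasDerivWithinAt_angularMomentum (h : GeodesicAt (metric m a) γ v S s)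
    (hx : 0 < rad (γ s)) (hD : Delta m a (rad (γ s)) ≠ 0) :
    HasDerivWithinAt (fun σ => pairing (metric m a) (γ σ) (rotGen (γ σ)) (v σ)) 0 S s := by
  have hF : HasDerivAt (fun σ : ℝ => pairing (metric m a) (rot σ (γ s)) (rot σ (v s))
      (rot σ (v s))) 0 0 := by
    simp only [pairing_metric_rot]
    exact hasDerivAt_const _ _
  have hξ : HasDerivWithinAt (fun σ => rotGen (γ σ)) (rotGen (v s)) S s := by
    have hγ := hasDerivWithinAt_pi.1 h.1
    refine hasDerivWithinAt_pi.2 fun k => ?_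
    fin_cases k
    · exact hasDerivWithinAt_const _ _ _
    · exact (hγ 2).neg
    · exact hγ 1
    · exact hasDerivWithinAt_const _ _ _
  have := hasDerivWithinAt_momentum_of_variation (metric_isSymm m a)
    (differentiableAt_metric m a hx hD) (det_metric_ne_zero hx hD) h.1 h.2
    hξ (rot_zero _) (rot_zero _) (hasDerivAt_rot _) (hasDerivAt_rot _) hF
  simpa using this

/-- A geodesic that starts on the axis and returns to its initial time is static: its velocity has
no component in the time and azimuthal directions. -/
lemma static_of_axis_of_time_eq (hm : 0 < m)
    (h : ∀ s ∈ Icc (0 : ℝ) 1, GeodesicAt (metric m a) γ v (Icc 0 1) s)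
    (hr : ∀ s ∈ Icc (0 : ℝ) 1, rPlus m a < rad (γ s)) (h1 : γ 0 1 = 0) (h2 : γ 0 2 = 0)
    (ht : γ 0 0 = γ 1 0) (hs : s ∈ Icc (0 : ℝ) 1) : v s 0 = 0 ∧ phiComp (γ s) (v s) = 0 := by
  have hx : ∀ s ∈ Icc (0 : ℝ) 1, 0 < rad (γ s) := fun s hs => (rPlus_pos hm a).trans (hr s hs)
  have hD : ∀ s ∈ Icc (0 : ℝ) 1, 0 < Delta m a (rad (γ s)) := fun s hs => Delta_pos (hr s hs)
  have h0 : (0 : ℝ) ∈ Icc (0 : ℝ) 1 := left_mem_Icc.2 zero_le_one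
  have hL : ∀ s ∈ Icc (0 : ℝ) 1, pairing (metric m a) (γ s) (rotGen (γ s)) (v s) = 0 := by
    intro s hs
    rw [eq_of_hasDerivWithinAt_zero (fun s hs =>
      hasDerivWithinAt_angularMomentum (h s hs) (hx s hs) (hD s hs).ne') hs h0]
    -- the rotations fix the axis
    have : rotGen (γ 0) = 0 := by
      ext k
      fin_cases k <;> simp [rotGen, h1, h2]
    simp [this, pairing]
  -- `t` returns to its initial value, so `t'` vanishes somewhere, and the conserved `pₜ` with it
  obtain ⟨σ, hσ, hσ0⟩ := exists_mem_Icc_deriv_eq_zero zero_lt_one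
    (fun s hs => hasDerivWithinAt_pi.1 (h s hs).1 0) ht
  have hE : pairing (metric m a) (γ s) ![1, 0, 0, 0] (v s) = 0 := by
    rw [eq_of_hasDerivWithinAt_zero (fun s hs =>
      hasDerivWithinAt_timeMomentum (h s hs) (hx s hs) (hD s hs).ne') hs hσ]
    have := phiCoeff_mul_pairing_time (hx σ hσ) (hL σ hσ)
    rw [hσ0, mul_zero] at this
    exact (mul_eq_zero.1 this).resolve_left (phiCoeff_pos hm a (hx σ hσ)).ne'
  have hv : v s 0 = 0 := by
    have := phiCoeff_mul_pairing_time (hx s hs) (hL s hs)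
    rw [hE, mul_zero] at this
    exact (mul_eq_zero.1 this.symm).resolve_left (neg_ne_zero.2 (hD s hs).ne')
  refine ⟨hv, ?_⟩
  have := hL s hs
  rw [pairing_metric_rotGen (hx s hs), hv, mul_zero, sub_zero] at this
  exact (mul_eq_zero.1 this).resolve_left (phiCoeff_pos hm a (hx s hs)).ne'

/-- The quantity `λ r' / √△`. On the `(r, θ)`-plane the metric is `λ (dρ² + dθ²)` with
`ρ = ∫ dr / √△`, and this is the momentum `λ ρ'`. -/
def radialMomentum (m a : ℝ) (x u : Fin 4 → ℝ) : ℝ :=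
  lam a (rad x) (cosTheta x) / √(Delta m a (rad x)) * radComp x u

/-- The radial equation of a static geodesic. The right hand side is nonnegative: static geodesics
turn outwards. -/
lemma hasDerivWithinAt_radialMomentum (h : GeodesicAt (metric m a) γ v S s) (hs : s ∈ S)
    (hx : ∀ s ∈ S, 0 < rad (γ s)) (hD : ∀ s ∈ S, 0 < Delta m a (rad (γ s)))
    (hv : v s 0 = 0) (hP : phiComp (γ s) (v s) = 0) :
    HasDerivWithinAt (fun σ => radialMomentum m a (γ σ) (v σ))
      (rad (γ s) * √(Delta m a (rad (γ s))) / lam a (rad (γ s)) (cosTheta (γ s))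
        * pairing (metric m a) (γ s) (v s) (v s)) S s := by
  have hξ : HasDerivWithinAt (fun σ => spatial (γ σ)) (spatial (v s)) S s := by
    have hγ := hasDerivWithinAt_pi.1 h.1
    refine hasDerivWithinAt_pi.2 fun k => ?_
    fin_cases k
    · exact hasDerivWithinAt_const _ _ _
    · exact hγ 1
    · exact hγ 2
    · exact hγ 3
  have hQ := hasDerivWithinAt_momentum_of_variation (metric_isSymm m a)
    (differentiableAt_metric m a (hx s hs) (hD s hs).ne')
    (det_metric_ne_zero (hx s hs) (hD s hs).ne') h.1 h.2
    hξ (dil_one _) (dil_one _) (hasDerivAt_dil _) (hasDerivAt_dil _)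
    (hasDerivAt_pairing_metric_dil (hx s hs) (hD s hs).ne' hv hP)
  have hR := hasDerivWithinAt_rad (hx s hs) h.1
  have hΔ : HasDerivWithinAt (fun σ => Delta m a (rad (γ σ)))
      (2 * (rad (γ s) - m) * radComp (γ s) (v s)) S s := by
    simp only [Delta]
    refine (((hR.fun_pow 2).fun_sub (hR.const_mul (2 * m))).add_const (a ^ 2)).congr_deriv ?_
    push_cast
    ring
  have hW := ((hΔ.sqrt (hD s hs).ne').fun_div hR (hx s hs).ne').fun_mul hQ
  refine (hW.congr_of_mem (fun σ hσ => ?_) hs).congr_deriv ?_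
  · rw [pairing_metric_spatial (hx σ hσ), radialMomentum]
    have hsq := Real.sq_sqrt (hD σ hσ).le
    have hpos := Real.sqrt_pos.2 (hD σ hσ)
    have hx := hx σ hσ
    generalize √(Delta m a (rad (γ σ))) = D at *
    rw [← hsq]
    field_simp
  · rw [pairing_metric_spatial (hx s hs), pairing_metric, hv, hP]
    have hsq := Real.sq_sqrt (hD s hs).le
    have hpos := Real.sqrt_pos.2 (hD s hs)
    have hx := hx s hs
    have hl := lam_pos a (cosTheta (γ s)) hx
    generalize √(Delta m a (rad (γ s))) = D at *
    rw [← hsq]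
    field_simp
    ring

end Geodesic

/-! ### Opposite points on the axis -/

lemma rad_axis (z : ℝ) : rad ![0, 0, 0, z] = |z| := by
  simp [rad, Real.sqrt_sq_eq_abs]

/-- The polar part `λ θ'²` of the speed of a static velocity bounds `r² ((cos θ)')²`, because
`r² ≤ λ` and `(cos θ)' = -sin θ θ'`. -/
lemma sq_deriv_cosTheta_mul_rad_sq_le {m a : ℝ} {x v : Fin 4 → ℝ} (hx : 0 < rad x)
    (hD : 0 < Delta m a (rad x)) (hv : v 0 = 0) (hP : phiComp x v = 0) :
    ((v 3 - cosTheta x * radComp x v) / rad x) ^ 2 * rad x ^ 2 ≤ pairing (metric m a) x v v := by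
  have h := sq_sub_cosTheta_mul_radComp_le hx v
  have hl : rad x ^ 2 ≤ lam a (rad x) (cosTheta x) := by
    rw [lam]
    nlinarith [sq_nonneg (a * cosTheta x)]
  have hl0 := lam_pos a (cosTheta x) hx
  have h1 : 1 ≤ lam a (rad x) (cosTheta x) / rad x ^ 2 := (one_le_div (by positivity)).2 hl
  have h2 : 0 ≤ lam a (rad x) (cosTheta x) / Delta m a (rad x) * (radComp x v * radComp x v) :=
    mul_nonneg (by positivity) (mul_self_nonneg _)
  have h3 := mul_le_mul h1 h (sq_nonneg _) (by positivity)
  rw [div_pow, div_mul_cancel₀ _ (by positivity), pairing_metric, hv, hP]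
  linarith

/-- Two points of the axis on opposite sides of the black hole, at the same time and at the same
radius, close enough to the boundary of `{r > r₀}`, are not joined by a geodesic in this region.
Such a geodesic would be static with a turning point of `r`, from which it would have to go through
at least a quarter turn of `θ` on one of its two sides; this raises `r` by more than the distance
to the boundary. -/
theorem exists_axis_points_not_joined {m a r₀ : ℝ} (hm : 0 < m) (h₀ : rPlus m a < r₀) :
    ∃ R, r₀ < R ∧ ∀ γ : ℝ → Fin 4 → ℝ, IsGeodesic (metric m a) γ →
      (∀ s ∈ Icc (0 : ℝ) 1, r₀ < rad (γ s)) → γ 0 = ![0, 0, 0, R] → γ 1 ≠ ![0, 0, 0, -R] := by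
  have hr₀ : 0 < r₀ := (rPlus_pos hm a).trans h₀
  have hd : 0 < √(Delta m a r₀) := Real.sqrt_pos.2 (Delta_pos h₀)
  -- on `{r₀ < r ≤ r₀ + 1}`, `√△ / λ ≥ b`, so that the radial momentum grows at least at the rate
  -- `r₀ b` times the speed
  obtain ⟨b, hb⟩ : ∃ b, b = √(Delta m a r₀) / ((r₀ + 1) ^ 2 + a ^ 2) := ⟨_, rfl⟩
  have hb0 : 0 < b := by
    rw [hb]
    positivity
  have hη : 0 < b * (r₀ * b) * r₀ ^ 2 / 4 := by positivity
  refine ⟨r₀ + min 1 (b * (r₀ * b) * r₀ ^ 2 / 4), by linarith [lt_min one_pos hη], ?_⟩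
  have hR1 := min_le_left 1 (b * (r₀ * b) * r₀ ^ 2 / 4)
  have hR2 := min_le_right 1 (b * (r₀ * b) * r₀ ^ 2 / 4)
  have hR0 := lt_min one_pos hη
  generalize min 1 (b * (r₀ * b) * r₀ ^ 2 / 4) = δ at *
  rintro γ ⟨v, hγ⟩ hU hp hq
  replace hγ : ∀ s ∈ Icc (0 : ℝ) 1, GeodesicAt (metric m a) γ v (Icc 0 1) s := hγ
  have hx : ∀ s ∈ Icc (0 : ℝ) 1, 0 < rad (γ s) := fun s hs => hr₀.trans (hU s hs)
  have hD : ∀ s ∈ Icc (0 : ℝ) 1, 0 < Delta m a (rad (γ s)) :=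
    fun s hs => Delta_pos (h₀.trans (hU s hs))
  have hl : ∀ s, s ∈ Icc (0 : ℝ) 1 → 0 < lam a (rad (γ s)) (cosTheta (γ s)) :=
    fun s hs => lam_pos a _ (hx s hs)
  have h0mem : (0 : ℝ) ∈ Icc (0 : ℝ) 1 := left_mem_Icc.2 zero_le_one
  have h1mem : (1 : ℝ) ∈ Icc (0 : ℝ) 1 := right_mem_Icc.2 zero_le_one
  have hstat := fun s (hs : s ∈ Icc (0 : ℝ) 1) => static_of_axis_of_time_eq hm hγ
    (fun s hs => h₀.trans (hU s hs)) (by simp [hp]) (by simp [hp]) (by simp [hp, hq]) hs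
  -- the speed `k`
  obtain ⟨k, hk⟩ : ∃ k, ∀ s ∈ Icc (0 : ℝ) 1, pairing (metric m a) (γ s) (v s) (v s) = k :=
    ⟨_, fun s hs => eq_of_hasDerivWithinAt_zero (fun s hs =>
      hasDerivWithinAt_speed (metric_isSymm m a) (uniqueDiffOn_Icc zero_lt_one s hs)
        (differentiableAt_metric m a (hx s hs) (hD s hs).ne')
        (det_metric_ne_zero (hx s hs) (hD s hs).ne') (hγ s hs).1 (hγ s hs).2) hs h0mem⟩
  have hang : ∀ s ∈ Icc (0 : ℝ) 1,
      ((v s 3 - cosTheta (γ s) * radComp (γ s) (v s)) / rad (γ s)) ^ 2 * rad (γ s) ^ 2 ≤ k :=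
    fun s hs => (sq_deriv_cosTheta_mul_rad_sq_le (hx s hs) (hD s hs) (hstat s hs).1
      (hstat s hs).2).trans (hk s hs).le
  have hk0 : 0 ≤ k := le_trans (by positivity) (hang 0 h0mem)
  -- the radius at the endpoints
  have hrp : rad (γ 0) = r₀ + δ := by rw [hp, rad_axis, abs_of_pos (by linarith)]
  have hrq : rad (γ 1) = r₀ + δ := by rw [hq, rad_axis, abs_neg, abs_of_pos (by linarith)]
  have hRne : r₀ + δ ≠ 0 := (add_pos hr₀ hR0).ne'
  have hcp : cosTheta (γ 0) = 1 := by
    rw [cosTheta, hrp, hp]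
    exact div_self hRne
  have hcq : cosTheta (γ 1) = -1 := by
    rw [cosTheta, hrq, hq]
    exact (neg_div _ _).trans (congrArg _ (div_self hRne))
  -- the radial motion
  have hr : ∀ s ∈ Icc (0 : ℝ) 1, HasDerivWithinAt (fun s => rad (γ s))
      (√(Delta m a (rad (γ s))) / lam a (rad (γ s)) (cosTheta (γ s))
        * radialMomentum m a (γ s) (v s)) (Icc 0 1) s := by
    intro s hs
    refine (hasDerivWithinAt_rad (hx s hs) (hγ s hs).1).congr_deriv ?_
    have h1 := hl s hs
    have h2 := Real.sqrt_pos.2 (hD s hs)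
    rw [radialMomentum]
    field_simp
  have hw : ∀ s ∈ Icc (0 : ℝ) 1, HasDerivWithinAt (fun s => radialMomentum m a (γ s) (v s))
      (rad (γ s) * √(Delta m a (rad (γ s))) / lam a (rad (γ s)) (cosTheta (γ s)) * k)
      (Icc 0 1) s := by
    intro s hs
    rw [← hk s hs]
    exact hasDerivWithinAt_radialMomentum (hγ s hs) hs hx hD (hstat s hs).1 (hstat s hs).2
  obtain ⟨σ, hσ, hσ0⟩ := exists_mem_Icc_deriv_eq_zero zero_lt_one hr (hrp.trans hrq.symm)
  have hwσ : radialMomentum m a (γ σ) (v σ) = 0 :=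
    (mul_eq_zero.1 hσ0).resolve_left (div_pos (Real.sqrt_pos.2 (hD σ hσ)) (hl σ hσ)).ne'
  have hle : ∀ s ∈ Icc (0 : ℝ) 1, rad (γ s) ≤ r₀ + δ := fun s hs =>
    le_of_turning_point hσ hwσ hr hw
      (fun s hs => by
        have := hl s hs
        have := hx s hs
        positivity)
      (fun s hs => (div_pos (Real.sqrt_pos.2 (hD s hs)) (hl s hs)).le) hrp.le hrq.le hs
  have hβ : ∀ s ∈ Icc (0 : ℝ) 1,
      b ≤ √(Delta m a (rad (γ s))) / lam a (rad (γ s)) (cosTheta (γ s)) := by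
    intro s hs
    rw [hb]
    refine div_le_div₀ (Real.sqrt_nonneg _) (Real.sqrt_le_sqrt (Delta_mono h₀.le (hU s hs).le))
      (hl s hs) ?_
    rw [lam]
    have h1 := pow_le_pow_left₀ (hx s hs).le ((hle s hs).trans (by linarith : _ ≤ r₀ + 1)) 2
    have h2 := mul_le_mul_of_nonneg_left (cosTheta_sq_le_one (hx s hs)) (sq_nonneg a)
    linarith
  have hgrow := fun s hs => turning_point_growth (s := s) (K := r₀ * b * k) hσ hwσ hr hw
    (by positivity) hb0.le (fun s hs => by
      rw [mul_div_assoc]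
      exact mul_le_mul_of_nonneg_right
        (mul_le_mul (hU s hs).le (hβ s hs) hb0.le (hx s hs).le) hk0) hβ hs
  -- the angular motion
  have hC : ∀ s ∈ Icc (0 : ℝ) 1, r₀ * |cosTheta (γ s) - cosTheta (γ σ)| ≤ √k * |s - σ| := by
    intro s hs
    have h := (convex_Icc (0 : ℝ) 1).norm_image_sub_le_of_norm_hasDerivWithin_le (C := √k / r₀)
      (fun s hs => hasDerivWithinAt_cosTheta (hx s hs) (hγ s hs).1) (fun s hs => by
        rw [le_div_iff₀ hr₀]
        refine Real.le_sqrt_of_sq_le (le_trans ?_ (hang s hs))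
        rw [mul_pow, Real.norm_eq_abs, sq_abs]
        have := hU s hs
        gcongr) hσ hs
    rw [Real.norm_eq_abs, Real.norm_eq_abs, div_mul_eq_mul_div, le_div_iff₀ hr₀] at h
    linarith
  -- an endpoint at angular distance from the turning point leads to a contradiction
  have hfar : ∀ s ∈ Icc (0 : ℝ) 1, rad (γ s) = r₀ + δ →
      1 ≤ |cosTheta (γ s) - cosTheta (γ σ)| → False := by
    intro s hs hs' h1
    have h2 : r₀ ≤ √k * |s - σ| := (le_mul_of_one_le_right hr₀.le h1).trans (hC s hs)
    have h3 : r₀ ^ 2 ≤ k * (s - σ) ^ 2 := by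
      have := pow_le_pow_left₀ hr₀.le h2 2
      rwa [mul_pow, Real.sq_sqrt hk0, sq_abs] at this
    have h4 := hgrow s hs
    have h5 := hU σ hσ
    have h6 := mul_le_mul_of_nonneg_left h3 (by positivity : 0 ≤ b * (r₀ * b) / 2)
    simp only [hs'] at h4
    linarith
  rcases le_total (cosTheta (γ σ)) 0 with h | h
  · exact hfar 0 h0mem hrp (by rw [hcp]; exact le_trans (by linarith) (le_abs_self _))
  · exact hfar 1 h1mem hrq (by rw [hcq]; exact le_trans (by linarith) (neg_le_abs _))

/-- The criterion that covers both kinds of region. -/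
lemma not_geodesicallyConnected {m a r₀ : ℝ} (hm : 0 < m) (h₀ : rPlus m a < r₀)
    {U : Set (Fin 4 → ℝ)} (hU : ∀ x ∈ U, r₀ < rad x)
    (haxis : ∀ z : ℝ, r₀ < |z| → ![0, 0, 0, z] ∈ U) :
    ¬ GeodesicallyConnected (metric m a) U := by
  obtain ⟨R, hR, h⟩ := exists_axis_points_not_joined hm h₀
  intro hconn
  obtain ⟨γ, hγ, hγU, hp, hq⟩ := hconn _ (haxis R (hR.trans_le (le_abs_self R)))
    _ (haxis (-R) (by rw [abs_neg]; exact hR.trans_le (le_abs_self R)))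
  exact h γ hγ (fun s hs => hU _ (hγU s hs)) hp hq

end Kerr

end

theorem mainTheorem5 (m a : ℝ) (hm : 0 < m) (ha : a ^ 2 ≤ m ^ 2) :
    (∀ ν : ℝ, 0 < ν →
      ¬ Kerr.GeodesicallyConnected (Kerr.metric m a) (Kerr.outerRegion m a ν)) ∧
    (∀ ε : ℝ, 0 < ε →
      ¬ Kerr.GeodesicallyConnected (Kerr.metric m a) (Kerr.stationaryRegion m a ε)) := by
  refine ⟨fun ν hν => ?_, fun ε hε => ?_⟩
  · refine Kerr.not_geodesicallyConnected (r₀ := Kerr.rPlus m a + ν) hm (by linarith)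
      (fun x hx => hx) fun z hz => ?_
    change Kerr.rPlus m a + ν < Kerr.rad _
    rwa [Kerr.rad_axis]
  · have h₀ : Kerr.rPlus m a < m + √(m ^ 2 + ε - a ^ 2) := by
      rw [Kerr.rPlus]
      gcongr
      linarith
    have hpos := (Kerr.rPlus_pos hm a).trans h₀
    refine Kerr.not_geodesicallyConnected hm h₀ (fun x hx => ?_) fun z hz => ?_
    · change m + √_ < Kerr.rad x at hx
      have hx0 : 0 < Kerr.rad x := (add_pos_of_pos_of_nonneg hm (Real.sqrt_nonneg _)).trans hx
      refine lt_of_le_of_lt ?_ hx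
      gcongr
      exact mul_le_of_le_one_right (sq_nonneg a) (Kerr.cosTheta_sq_le_one hx0)
    · change m + √_ < Kerr.rad _
      have hc : Kerr.cosTheta ![0, 0, 0, z] ^ 2 = 1 := by
        rw [Kerr.cosTheta, Kerr.rad_axis, div_pow, sq_abs]
        exact div_self (pow_ne_zero 2 (abs_pos.1 (hpos.trans hz)))
      rwa [hc, mul_one, Kerr.rad_axis]
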